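/- Let $q$ be a power of a prime, let $\mathbb{F}_q\subset\mathbb{F}_{q^3}$ be the finite fields with $q$ and $q^3$ elements, and let $\mu_{q^2+q+1}=\{x\in\mathbb{F}_{q^3} : x^{q^2+q+1}=1\}$. Put $$r_1(v,w)=(v+w+1)(v^2+v+1)^6(v^2-vw-v+w^2-w+1)(v^3+vw+1)^5(v^4-2v^2w+vw^3-v+w^2)(v^4-v^2w+v-w^2)^2(v^4+2v^2w-v+w^2),$$ $$r_2(v,w)=(v-w-1)(v^2-v+1)^6(v^2+vw+v+w^2-w+1)(v^3+vw-1)^5(v^4-2v^2w-vw^3+v+w^2)(v^4-v^2w-v-w^2)^2(v^4+2v^2w+v+w^2).$$ Theorem 3.9. Let $A,B,C\in\mathbb{F}_q$ with $A\neq -1,0,1$, $A^2-A+1\neq 0$, $AB^2+C^2\neq 0$, $A^3-2A^2B+AB^2+1\neq 0$ and $A^3-A^2B+AB^2+C^2-C+1=0$. Assume that $r_1(A,B)\neq 0$, that $r_2(A,B)\neq 0$, and that no $u\in\mu_{q^2+q+1}$ satisfies $m_{A,B,C}(u)=0$, where $m_{A,B,C}(t)=\lambda_1t^3+\lambda_2t^2+\lambda_3t+\lambda_4$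 has the coefficients $\lambda_i=\lambda_i(A,B,C)\in\mathbb{F}_q$ listed below. Then $$f(x)=x^{q^2+q-1}+Ax^{q^2-q+1}+Bx^q+Cx$$ is a permutation polynomial over $\mathbb{F}_{q^3}$, that is, $c\mapsto f(c)$ is a bijection of $\mathbb{F}_{q^3}$ onto itself. The coefficients are $$\begin{aligned}\lambda_1={}&A^{2} B^{16} + 6 A^{2} B^{13} C^{2} - 6 A^{2} B^{13} C + 6 A^{2} B^{13} + 9 A^{2} B^{10} C^{4} \\ &- 30 A^{2} B^{10} C^{3} + 24 A^{2} B^{10} C^{2} - 30 A^{2} B^{10} C + 9 A^{2} B^{10} \\ &+ 4 A^{2} B^{7} C^{6} - 30 A^{2} B^{7} C^{5} + 30 A^{2} B^{7} C^{4} - 32 A^{2} B^{7} C^{3} \\ &+ 30 A^{2} B^{7} C^{2} - 30 A^{2} B^{7} C + 4 A^{2} B^{7} - 15 A^{2} B^{4} C^{6} \\ &+ 70 A^{2} B^{4} C^{5} - 85 A^{2} B^{4} C^{4} + 70 A^{2} B^{4} C^{3} - 15 A^{2} B^{4} C^{2} \\ &- 6 A^{2} B C^{5} - A B^{17} - 3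 A B^{14} C^{2} + 9 A B^{14} C - 3 A B^{14} + 30 A B^{11} C^{3} \\ &- 30 A B^{11} C^{2} + 30 A B^{11} C + 2 A B^{8} C^{6} + 24 A B^{8} C^{5} - 78 A B^{8} C^{4} \\ &+ 86 A B^{8} C^{3} - 78 A B^{8} C^{2} + 24 A B^{8} C + 2 A B^{8} + 6 A B^{5} C^{7} \\ &- 48 A B^{5} C^{6} + 76 A B^{5} C^{5} - 97 A B^{5} C^{4} + 76 A B^{5} C^{3} - 48 A B^{5} C^{2} \\ &+ 6 A B^{5} C + 15 A B^{2} C^{6} - 15 A B^{2} C^{5} + 15 A B^{2} C^{4} - B^{15} C^{2} + B^{15} C \\ &- B^{15} - 3 B^{12} C^{4} + 12 B^{12} C^{3} - 15 B^{12} C^{2} + 12 B^{12} C - 3 B^{12} \\ &- 2 B^{9} C^{6} + 30 B^{9} C^{5} - 60 B^{9} C^{4} + 86 B^{9} C^{3} - 60 B^{9} C^{2} + 30 B^{9} C \\ &- 2 B^{9} - B^{6} C^{8} + 22 B^{6} C^{7} - 79 B^{6} C^{6} + 134 B^{6} C^{5} - 170 B^{6} C^{4} \\ &+ 134 B^{6}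 C^{3} - 79 B^{6} C^{2} + 22 B^{6} C - B^{6} - 20 B^{3} C^{7} + 55 B^{3} C^{6} \\ &- 75 B^{3} C^{5} + 55 B^{3} C^{4} - 20 B^{3} C^{3} - C^{6},\end{aligned}$$ $$\begin{aligned}\lambda_2={}&2 A^{2} B^{15} C - A^{2} B^{15} + 9 A^{2} B^{12} C^{3} - 15 A^{2} B^{12} C^{2} + 20 A^{2} B^{12} C \\ &- A^{2} B^{12} + 11 A^{2} B^{9} C^{5} - 51 A^{2} B^{9} C^{4} + 81 A^{2} B^{9} C^{3} \\ &- 89 A^{2} B^{9} C^{2} + 39 A^{2} B^{9} C + A^{2} B^{9} + 5 A^{2} B^{6} C^{7} - 46 A^{2} B^{6} C^{6} \\ &+ 103 A^{2} B^{6} C^{5} - 171 A^{2} B^{6} C^{4} + 167 A^{2} B^{6} C^{3} - 121 A^{2} B^{6} C^{2} \\ &+ 28 A^{2} B^{6} C - A^{2} B^{6} - 10 A^{2} B^{3} C^{7} + 50 A^{2} B^{3} C^{6} \\ &- 75 A^{2} B^{3} C^{5} + 70 A^{2} B^{3} C^{4} - 20 A^{2} B^{3} C^{3} - A^{2} C^{6}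 - A B^{16} C \\ &- A B^{16} + 2 A B^{13} C^{2} + 3 A B^{13} C - 8 A B^{13} + 7 A B^{10} C^{5} + 9 A B^{10} C^{4} \\ &+ 5 A B^{10} C^{2} + 31 A B^{10} C - 12 A B^{10} + 5 A B^{7} C^{7} + 6 A B^{7} C^{6} \\ &- 48 A B^{7} C^{5} + 76 A B^{7} C^{4} - 62 A B^{7} C^{3} + 6 A B^{7} C^{2} + 27 A B^{7} C \\ &- 4 A B^{7} + 5 A B^{4} C^{8} - 45 A B^{4} C^{7} + 100 A B^{4} C^{6} - 155 A B^{4} C^{5} \\ &+ 135 A B^{4} C^{4} - 85 A B^{4} C^{3} + 15 A B^{4} C^{2} + 5 A B C^{7} - 6 A B C^{6} + 6 A B C^{5} \\ &- B^{14} C^{3} - B^{14} - B^{11} C^{5} + 6 B^{11} C^{4} - 6 B^{11} C^{3} - B^{11} C^{2} + 6 B^{11} C \\ &- 6 B^{11} + B^{8} C^{7} + 21 B^{8} C^{6} - 51 B^{8} C^{5} + 87 B^{8} C^{4} - 57 B^{8} C^{3} \\ &+ 21 B^{8} C^{2} + 14 B^{8} C - 6 B^{8} - B^{5} C^{9} +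 24 B^{5} C^{8} - 105 B^{5} C^{7} \\ &+ 231 B^{5} C^{6} - 339 B^{5} C^{5} + 321 B^{5} C^{4} - 200 B^{5} C^{3} + 69 B^{5} C^{2} - 6 B^{5} C \\ &- 10 B^{2} C^{8} + 30 B^{2} C^{7} - 45 B^{2} C^{6} + 36 B^{2} C^{5} - 15 B^{2} C^{4},\end{aligned}$$ $$\begin{aligned}\lambda_3={}&(C+1)\big(A^{2} B^{14} C + 3 A^{2} B^{11} C^{3} - 6 A^{2} B^{11} C^{2} + 6 A^{2} B^{11} C + 2 A^{2} B^{11} \\ &+ 2 A^{2} B^{8} C^{5} - 21 A^{2} B^{8} C^{4} + 30 A^{2} B^{8} C^{3} - 35 A^{2} B^{8} C^{2} \\ &+ 6 A^{2} B^{8} C + 3 A^{2} B^{8} + A^{2} B^{5} C^{7} - 18 A^{2} B^{5} C^{6} + 51 A^{2} B^{5} C^{5} \\ &- 82 A^{2} B^{5} C^{4} + 81 A^{2} B^{5} C^{3} - 48 A^{2} B^{5} C^{2} + 6 A^{2} B^{5} C \\ &+ 10 A^{2} B^{2} C^{6} - 15 A^{2} B^{2} C^{5} + 15 A^{2} B^{2}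 C^{4} - A B^{15} + 3 A B^{12} C^{3} \\ &- 3 A B^{12} C^{2} + 8 A B^{12} C - 5 A B^{12} + 7 A B^{9} C^{5} - 9 A B^{9} C^{4} \\ &+ 21 A B^{9} C^{3} - 19 A B^{9} C^{2} + 27 A B^{9} C - 5 A B^{9} + 3 A B^{6} C^{7} \\ &- 10 A B^{6} C^{6} + A B^{6} C^{5} - 7 A B^{6} C^{4} + 5 A B^{6} C^{3} - 25 A B^{6} C^{2} \\ &+ 16 A B^{6} C - A B^{6} - 10 A B^{3} C^{7} + 30 A B^{3} C^{6} - 45 A B^{3} C^{5} + 40 A B^{3} C^{4} \\ &- 20 A B^{3} C^{3} - A C^{6} - B^{13} C^{2} + B^{13} C - B^{13} + 2 B^{10} C^{5} - 3 B^{10} C^{4} \\ &+ 9 B^{10} C^{3} - 11 B^{10} C^{2} + 10 B^{10} C - 4 B^{10} + 3 B^{7} C^{7} - 2 B^{7} C^{6} \\ &+ 2 B^{7} C^{5} + B^{7} C^{4} + 14 B^{7} C^{3} - 17 B^{7} C^{2} + 17 B^{7} C - 3 B^{7} \\ &+ 5 B^{4} C^{8} - 35 B^{4} C^{7} + 80 B^{4}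 C^{6} - 125 B^{4} C^{5} + 110 B^{4} C^{4} \\ &- 65 B^{4} C^{3} + 15 B^{4} C^{2} + 5 B C^{7} - 5 B C^{6} + 6 B C^{5}\big),\end{aligned}$$ $$\lambda_4=-\lambda_1.$$ -/

import Mathlib

open Polynomial

namespace PermQuad

/-- A polynomial `f` with coefficients in `K` is a permutation polynomial over the extension `L`
if the associated polynomial function `c ↦ f(c)` from `L` to `L` is a permutation of `L`. -/
def IsPermutationPolynomialOver {K : Type*} (L : Type*) [Field K] [Field L] [Algebra K L]
    (f : K[X]) : Prop :=
  Function.Bijective fun c : L => aeval c f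

/-- The set `μ_d` of `d`-th roots of unity in `L`. -/
def mu (L : Type*) [Field L] (d : ℕ) : Set L :=
  {x | x ^ d = 1}

section Coefficients

variable {K : Type*} [CommRing K]

/-- The bivariate polynomial `r₁(v, w)`. -/
def r₁ (v w : K) : K :=
  (v + w + 1) * (v ^ 2 + v + 1) ^ 6 * (v ^ 2 - v * w - v + w ^ 2 - w + 1) *
    (v ^ 3 + v * w + 1) ^ 5 * (v ^ 4 - 2 * v ^ 2 * w + v * w ^ 3 - v + w ^ 2) *
    (v ^ 4 - v ^ 2 * w + v - w ^ 2) ^ 2 * (v ^ 4 + 2 * v ^ 2 * w - v + w ^ 2)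

/-- The bivariate polynomial `r₂(v, w)`. -/
def r₂ (v w : K) : K :=
  (v - w - 1) * (v ^ 2 - v + 1) ^ 6 * (v ^ 2 + v * w + v + w ^ 2 - w + 1) *
    (v ^ 3 + v * w - 1) ^ 5 * (v ^ 4 - 2 * v ^ 2 * w - v * w ^ 3 + v + w ^ 2) *
    (v ^ 4 - v ^ 2 * w - v - w ^ 2) ^ 2 * (v ^ 4 + 2 * v ^ 2 * w + v + w ^ 2)

/-- The coefficient of `A²` in `λ₁`. -/
def lam₁₂ (B C : K) : K :=
  B ^ 16 + 6 * B ^ 13 * C ^ 2 - 6 * B ^ 13 * C + 6 * B ^ 13 + 9 * B ^ 10 * C ^ 4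
    - 30 * B ^ 10 * C ^ 3 + 24 * B ^ 10 * C ^ 2 - 30 * B ^ 10 * C + 9 * B ^ 10
    + 4 * B ^ 7 * C ^ 6 - 30 * B ^ 7 * C ^ 5 + 30 * B ^ 7 * C ^ 4 - 32 * B ^ 7 * C ^ 3
    + 30 * B ^ 7 * C ^ 2 - 30 * B ^ 7 * C + 4 * B ^ 7 - 15 * B ^ 4 * C ^ 6 + 70 * B ^ 4 * C ^ 5
    - 85 * B ^ 4 * C ^ 4 + 70 * B ^ 4 * C ^ 3 - 15 * B ^ 4 * C ^ 2 - 6 * B * C ^ 5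

/-- The coefficient of `A` in `λ₁`. -/
def lam₁₁ (B C : K) : K :=
  -B ^ 17 - 3 * B ^ 14 * C ^ 2 + 9 * B ^ 14 * C - 3 * B ^ 14 + 30 * B ^ 11 * C ^ 3
    - 30 * B ^ 11 * C ^ 2 + 30 * B ^ 11 * C + 2 * B ^ 8 * C ^ 6 + 24 * B ^ 8 * C ^ 5
    - 78 * B ^ 8 * C ^ 4 + 86 * B ^ 8 * C ^ 3 - 78 * B ^ 8 * C ^ 2 + 24 * B ^ 8 * C + 2 * B ^ 8
    + 6 * B ^ 5 * C ^ 7 - 48 * B ^ 5 * C ^ 6 + 76 * B ^ 5 * C ^ 5 - 97 * B ^ 5 * C ^ 4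
    + 76 * B ^ 5 * C ^ 3 - 48 * B ^ 5 * C ^ 2 + 6 * B ^ 5 * C + 15 * B ^ 2 * C ^ 6
    - 15 * B ^ 2 * C ^ 5 + 15 * B ^ 2 * C ^ 4

/-- The coefficient of `A⁰` in `λ₁`. -/
def lam₁₀ (B C : K) : K :=
  -B ^ 15 * C ^ 2 + B ^ 15 * C - B ^ 15 - 3 * B ^ 12 * C ^ 4 + 12 * B ^ 12 * C ^ 3
    - 15 * B ^ 12 * C ^ 2 + 12 * B ^ 12 * C - 3 * B ^ 12 - 2 * B ^ 9 * C ^ 6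
    + 30 * B ^ 9 * C ^ 5 - 60 * B ^ 9 * C ^ 4 + 86 * B ^ 9 * C ^ 3 - 60 * B ^ 9 * C ^ 2
    + 30 * B ^ 9 * C - 2 * B ^ 9 - B ^ 6 * C ^ 8 + 22 * B ^ 6 * C ^ 7 - 79 * B ^ 6 * C ^ 6
    + 134 * B ^ 6 * C ^ 5 - 170 * B ^ 6 * C ^ 4 + 134 * B ^ 6 * C ^ 3 - 79 * B ^ 6 * C ^ 2
    + 22 * B ^ 6 * C - B ^ 6 - 20 * B ^ 3 * C ^ 7 + 55 * B ^ 3 * C ^ 6 - 75 * B ^ 3 * C ^ 5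
    + 55 * B ^ 3 * C ^ 4 - 20 * B ^ 3 * C ^ 3 - C ^ 6

/-- The coefficient of `t³` in `m_{A,B,C}(t)`. -/
def lam₁ (A B C : K) : K :=
  A ^ 2 * lam₁₂ B C + A * lam₁₁ B C + lam₁₀ B C

/-- The coefficient of `A²` in `λ₂`. -/
def lam₂₂ (B C : K) : K :=
  2 * B ^ 15 * C - B ^ 15 + 9 * B ^ 12 * C ^ 3 - 15 * B ^ 12 * C ^ 2 + 20 * B ^ 12 * C
    - B ^ 12 + 11 * B ^ 9 * C ^ 5 - 51 * B ^ 9 * C ^ 4 + 81 * B ^ 9 * C ^ 3 - 89 * B ^ 9 * C ^ 2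
    + 39 * B ^ 9 * C + B ^ 9 + 5 * B ^ 6 * C ^ 7 - 46 * B ^ 6 * C ^ 6 + 103 * B ^ 6 * C ^ 5
    - 171 * B ^ 6 * C ^ 4 + 167 * B ^ 6 * C ^ 3 - 121 * B ^ 6 * C ^ 2 + 28 * B ^ 6 * C - B ^ 6
    - 10 * B ^ 3 * C ^ 7 + 50 * B ^ 3 * C ^ 6 - 75 * B ^ 3 * C ^ 5 + 70 * B ^ 3 * C ^ 4
    - 20 * B ^ 3 * C ^ 3 - C ^ 6

/-- The coefficient of `A` in `λ₂`. -/
def lam₂₁ (B C : K) : K :=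
  -B ^ 16 * C - B ^ 16 + 2 * B ^ 13 * C ^ 2 + 3 * B ^ 13 * C - 8 * B ^ 13 + 7 * B ^ 10 * C ^ 5
    + 9 * B ^ 10 * C ^ 4 + 5 * B ^ 10 * C ^ 2 + 31 * B ^ 10 * C - 12 * B ^ 10
    + 5 * B ^ 7 * C ^ 7 + 6 * B ^ 7 * C ^ 6 - 48 * B ^ 7 * C ^ 5 + 76 * B ^ 7 * C ^ 4
    - 62 * B ^ 7 * C ^ 3 + 6 * B ^ 7 * C ^ 2 + 27 * B ^ 7 * C - 4 * B ^ 7 + 5 * B ^ 4 * C ^ 8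
    - 45 * B ^ 4 * C ^ 7 + 100 * B ^ 4 * C ^ 6 - 155 * B ^ 4 * C ^ 5 + 135 * B ^ 4 * C ^ 4
    - 85 * B ^ 4 * C ^ 3 + 15 * B ^ 4 * C ^ 2 + 5 * B * C ^ 7 - 6 * B * C ^ 6 + 6 * B * C ^ 5

/-- The coefficient of `A⁰` in `λ₂`. -/
def lam₂₀ (B C : K) : K :=
  -B ^ 14 * C ^ 3 - B ^ 14 - B ^ 11 * C ^ 5 + 6 * B ^ 11 * C ^ 4 - 6 * B ^ 11 * C ^ 3
    - B ^ 11 * C ^ 2 + 6 * B ^ 11 * C - 6 * B ^ 11 + B ^ 8 * C ^ 7 + 21 * B ^ 8 * C ^ 6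
    - 51 * B ^ 8 * C ^ 5 + 87 * B ^ 8 * C ^ 4 - 57 * B ^ 8 * C ^ 3 + 21 * B ^ 8 * C ^ 2
    + 14 * B ^ 8 * C - 6 * B ^ 8 - B ^ 5 * C ^ 9 + 24 * B ^ 5 * C ^ 8 - 105 * B ^ 5 * C ^ 7
    + 231 * B ^ 5 * C ^ 6 - 339 * B ^ 5 * C ^ 5 + 321 * B ^ 5 * C ^ 4 - 200 * B ^ 5 * C ^ 3
    + 69 * B ^ 5 * C ^ 2 - 6 * B ^ 5 * C - 10 * B ^ 2 * C ^ 8 + 30 * B ^ 2 * C ^ 7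
    - 45 * B ^ 2 * C ^ 6 + 36 * B ^ 2 * C ^ 5 - 15 * B ^ 2 * C ^ 4

/-- The coefficient of `t²` in `m_{A,B,C}(t)`. -/
def lam₂ (A B C : K) : K :=
  A ^ 2 * lam₂₂ B C + A * lam₂₁ B C + lam₂₀ B C

/-- The coefficient of `A²` in the cofactor of `C + 1` in `λ₃`. -/
def lam₃₂ (B C : K) : K :=
  B ^ 14 * C + 3 * B ^ 11 * C ^ 3 - 6 * B ^ 11 * C ^ 2 + 6 * B ^ 11 * C + 2 * B ^ 11
    + 2 * B ^ 8 * C ^ 5 - 21 * B ^ 8 * C ^ 4 + 30 * B ^ 8 * C ^ 3 - 35 * B ^ 8 * C ^ 2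
    + 6 * B ^ 8 * C + 3 * B ^ 8 + B ^ 5 * C ^ 7 - 18 * B ^ 5 * C ^ 6 + 51 * B ^ 5 * C ^ 5
    - 82 * B ^ 5 * C ^ 4 + 81 * B ^ 5 * C ^ 3 - 48 * B ^ 5 * C ^ 2 + 6 * B ^ 5 * C
    + 10 * B ^ 2 * C ^ 6 - 15 * B ^ 2 * C ^ 5 + 15 * B ^ 2 * C ^ 4

/-- The coefficient of `A` in the cofactor of `C + 1` in `λ₃`. -/
def lam₃₁ (B C : K) : K :=
  -B ^ 15 + 3 * B ^ 12 * C ^ 3 - 3 * B ^ 12 * C ^ 2 + 8 * B ^ 12 * C - 5 * B ^ 12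
    + 7 * B ^ 9 * C ^ 5 - 9 * B ^ 9 * C ^ 4 + 21 * B ^ 9 * C ^ 3 - 19 * B ^ 9 * C ^ 2
    + 27 * B ^ 9 * C - 5 * B ^ 9 + 3 * B ^ 6 * C ^ 7 - 10 * B ^ 6 * C ^ 6 + B ^ 6 * C ^ 5
    - 7 * B ^ 6 * C ^ 4 + 5 * B ^ 6 * C ^ 3 - 25 * B ^ 6 * C ^ 2 + 16 * B ^ 6 * C - B ^ 6
    - 10 * B ^ 3 * C ^ 7 + 30 * B ^ 3 * C ^ 6 - 45 * B ^ 3 * C ^ 5 + 40 * B ^ 3 * C ^ 4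
    - 20 * B ^ 3 * C ^ 3 - C ^ 6

/-- The coefficient of `A⁰` in the cofactor of `C + 1` in `λ₃`. -/
def lam₃₀ (B C : K) : K :=
  -B ^ 13 * C ^ 2 + B ^ 13 * C - B ^ 13 + 2 * B ^ 10 * C ^ 5 - 3 * B ^ 10 * C ^ 4
    + 9 * B ^ 10 * C ^ 3 - 11 * B ^ 10 * C ^ 2 + 10 * B ^ 10 * C - 4 * B ^ 10
    + 3 * B ^ 7 * C ^ 7 - 2 * B ^ 7 * C ^ 6 + 2 * B ^ 7 * C ^ 5 + B ^ 7 * C ^ 4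
    + 14 * B ^ 7 * C ^ 3 - 17 * B ^ 7 * C ^ 2 + 17 * B ^ 7 * C - 3 * B ^ 7 + 5 * B ^ 4 * C ^ 8
    - 35 * B ^ 4 * C ^ 7 + 80 * B ^ 4 * C ^ 6 - 125 * B ^ 4 * C ^ 5 + 110 * B ^ 4 * C ^ 4
    - 65 * B ^ 4 * C ^ 3 + 15 * B ^ 4 * C ^ 2 + 5 * B * C ^ 7 - 5 * B * C ^ 6 + 6 * B * C ^ 5

/-- The coefficient of `t` in `m_{A,B,C}(t)`. -/
def lam₃ (A B C : K) : K :=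
  (C + 1) * (A ^ 2 * lam₃₂ B C + A * lam₃₁ B C + lam₃₀ B C)

/-- The constant coefficient of `m_{A,B,C}(t)`; written out, it is term by term the negative of the
leading coefficient. -/
def lam₄ (A B C : K) : K :=
  -lam₁ A B C

/-- The cubic `m_{A,B,C}(t) = λ₁ t³ + λ₂ t² + λ₃ t + λ₄` over `K`. -/
noncomputable def m (A B C : K) : K[X] :=
  Polynomial.C (lam₁ A B C) * X ^ 3 + Polynomial.C (lam₂ A B C) * X ^ 2 +
    Polynomial.C (lam₃ A B C) * X + Polynomial.C (lam₄ A B C)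

/-- The polynomial `x^{q²+q-1} + A x^{q²-q+1} + B x^q + C x` over `K`. -/
noncomputable def f (q : ℕ) (A B C : K) : K[X] :=
  X ^ (q ^ 2 + q - 1) + Polynomial.C A * X ^ (q ^ 2 - q + 1) + Polynomial.C B * X ^ q +
    Polynomial.C C * X

end Coefficients

end PermQuad

/-! Let `σ` be Frobenius, `N x` the norm of `x`, and `a = σ x * σ (σ x)`, which is `N x / x` for
nonzero `x`. Then `f(x) * N x` is the value at `a` of a quadratic map Q, given by `conic`
(`aeval_f_mul`), and `f` commutes with scalars from `K`. Injectivity thus reduces to showing that Q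
separates lines of `L` over `K`. On the surface `surf = 0` the three conjugate conics satisfy a
linear syzygy (`syzygy`). For fixed `w`, every `a` with Q(a) proportional to `w` therefore lies in
the kernel of the linear map `syz w`. Suppose this kernel has dimension at least 2. Then some
non-scalar `d` is trace-orthogonal to the range; passing to the adjoint (`trace_mul_syz`) gives a
nonzero `a` killed by `syzAdj`, and a determinant identity (`syzygy_minor`) forces Q(a) = 0 when `B
≠ A * C`. Finally, Q has no nonzero zero: eliminating from the conjugate conics makes `a / σ a`, an
element of `mu`, a root of `m` (`conic_ne_zero`). The case `B = A * C` would make 1 a root of `m`.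
-/

namespace PermQuad

/-! ### Polynomial identities on the surface -/

section Identities

variable {R : Type*} [CommRing R]

/-- The quadratic form whose cyclic conjugates define the plane quadratic map behind `f`. -/
def conic (A B C a b c : R) : R :=
  a ^ 2 + A * b ^ 2 + B * a * c + C * b * c

/-- The first of the two linear forms that generate the syzygies of the conics. -/
def syzU (A B C a b c : R) : R :=
  A * B * a + A * b + (1 - C) * c

/-- The second of the two linear forms that generate the syzygies of the conics. -/
def syzV (A B C a b c : R) : R :=
  A ^ 2 * a + (A - B) * b - C * c

/-- The left-hand side of the equation of the surface on which `(A, B, C)` lies. -/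
def surf (A B C : R) : R :=
  A ^ 3 - A ^ 2 * B + A * B ^ 2 + C ^ 2 - C + 1

theorem syzygy {A B C : R} (h : surf A B C = 0) (a b c : R) :
    syzV A B C a b c * conic A B C a b c
      + (syzU A B C b c a - syzV A B C b c a) * conic A B C b c a
      - syzU A B C c a b * conic A B C c a b = 0 := by
  unfold syzU syzV conic
  unfold surf at h
  linear_combination (a * b ^ 2 - b * c ^ 2) * h

/-- The left side is the determinant of the 2×2 system that arises in
`conic_eq_zero_of_syzAdj_eq_zero`. -/
theorem syzygy_minor {A B C : R} (h : surf A B C = 0) (a b c : R) :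
    syzU A B C b c a * syzU A B C c a b - syzV A B C c a b * syzU A B C b c a
      + syzV A B C b c a * syzV A B C c a b = (B - A * C) * conic A B C a b c := by
  unfold syzU syzV conic
  unfold surf at h
  linear_combination (a * b + A * b * c) * h

/-- The coefficient of the first of two cubics of small degree whose combination is `m`. -/
def mulG (A B C : R) : R :=
  -(A * lam₁₂ B C + lam₃₂ B C)

/-- The coefficient of the second of two cubics of small degree whose combination is `m`. -/
def mulH (B C : R) : R :=
  B ^ 15 * C - B ^ 15 + 6 * B ^ 12 * C ^ 3 - 9 * B ^ 12 * C ^ 2 + 14 * B ^ 12 * C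
    - 3 * B ^ 12 + 9 * B ^ 9 * C ^ 5 - 30 * B ^ 9 * C ^ 4 + 51 * B ^ 9 * C ^ 3
    - 54 * B ^ 9 * C ^ 2 + 33 * B ^ 9 * C - 2 * B ^ 9 + 4 * B ^ 6 * C ^ 7
    - 28 * B ^ 6 * C ^ 6 + 52 * B ^ 6 * C ^ 5 - 89 * B ^ 6 * C ^ 4 + 86 * B ^ 6 * C ^ 3
    - 73 * B ^ 6 * C ^ 2 + 22 * B ^ 6 * C - B ^ 6 - 10 * B ^ 3 * C ^ 7 + 40 * B ^ 3 * C ^ 6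
    - 60 * B ^ 3 * C ^ 5 + 55 * B ^ 3 * C ^ 4 - 20 * B ^ 3 * C ^ 3 - C ^ 6

/-- With `lam₂_eq` and `lam₃_eq`, this splits `m` into two much smaller cubics, each obtainable by
elimination from the conics. Only this coefficient splits without the surface equation. -/
theorem lam₁_eq (A B C : R) :
    lam₁ A B C = mulG A B C * (B * C - A) + mulH B C * (1 + A * B ^ 2) := by
  unfold lam₁ mulG mulH lam₁₂ lam₁₁ lam₁₀ lam₃₂
  ring

theorem lam₂_eq {A B C : R} (h : surf A B C = 0) :
    lam₂ A B C = -mulG A B C * (A ^ 3 + B ^ 3)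
      - mulH B C * (B ^ 2 - A ^ 2 - B ^ 2 * C - A * B * C) := by
  unfold lam₂ mulG mulH lam₂₂ lam₂₁ lam₂₀ lam₁₂ lam₃₂
  unfold surf at h
  linear_combination (-A * B ^ 16 - 6 * A * B ^ 13 * C ^ 2 + 6 * A * B ^ 13 * C - 6 * A * B ^ 13
      - 9 * A * B ^ 10 * C ^ 4 + 30 * A * B ^ 10 * C ^ 3 - 24 * A * B ^ 10 * C ^ 2
      + 30 * A * B ^ 10 * C - 9 * A * B ^ 10 - 4 * A * B ^ 7 * C ^ 6 + 30 * A * B ^ 7 * C ^ 5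
      - 30 * A * B ^ 7 * C ^ 4 + 32 * A * B ^ 7 * C ^ 3 - 30 * A * B ^ 7 * C ^ 2
      + 30 * A * B ^ 7 * C - 4 * A * B ^ 7 + 15 * A * B ^ 4 * C ^ 6 - 70 * A * B ^ 4 * C ^ 5
      + 85 * A * B ^ 4 * C ^ 4 - 70 * A * B ^ 4 * C ^ 3 + 15 * A * B ^ 4 * C ^ 2
      + 6 * A * B * C ^ 5 - B ^ 17 - 6 * B ^ 14 * C ^ 2 + 5 * B ^ 14 * C - 6 * B ^ 14
      - 9 * B ^ 11 * C ^ 4 + 27 * B ^ 11 * C ^ 3 - 18 * B ^ 11 * C ^ 2 + 24 * B ^ 11 * C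
      - 11 * B ^ 11 - 4 * B ^ 8 * C ^ 6 + 28 * B ^ 8 * C ^ 5 - 9 * B ^ 8 * C ^ 4
      + 2 * B ^ 8 * C ^ 3 + 5 * B ^ 8 * C ^ 2 + 24 * B ^ 8 * C - 7 * B ^ 8 - B ^ 5 * C ^ 7
      + 33 * B ^ 5 * C ^ 6 - 121 * B ^ 5 * C ^ 5 + 167 * B ^ 5 * C ^ 4 - 151 * B ^ 5 * C ^ 3
      + 63 * B ^ 5 * C ^ 2 - 6 * B ^ 5 * C - 10 * B ^ 2 * C ^ 6 + 21 * B ^ 2 * C ^ 5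
      - 15 * B ^ 2 * C ^ 4) * h

theorem lam₃_eq {A B C : R} (h : surf A B C = 0) :
    lam₃ A B C = -mulG A B C * ((1 + C) * (A ^ 2 - A * B + B ^ 2))
      + mulH B C * (-2 * B + A + B * C + A * C - A * B ^ 3 + A ^ 2 * B ^ 2 - A ^ 3 * B) := by
  unfold lam₃ mulG mulH lam₃₂ lam₃₁ lam₃₀ lam₁₂
  unfold surf at h
  linear_combination (-2 * B ^ 16 - 9 * B ^ 13 * C ^ 2 + 14 * B ^ 13 * C - 9 * B ^ 13 - 9 * B ^ 10 * C ^ 4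
      + 57 * B ^ 10 * C ^ 3 - 48 * B ^ 10 * C ^ 2 + 54 * B ^ 10 * C - 11 * B ^ 10
      - 2 * B ^ 7 * C ^ 6 + 52 * B ^ 7 * C ^ 5 - 87 * B ^ 7 * C ^ 4 + 88 * B ^ 7 * C ^ 3
      - 73 * B ^ 7 * C ^ 2 + 48 * B ^ 7 * C - 5 * B ^ 7 + 5 * B ^ 4 * C ^ 7
      - 15 * B ^ 4 * C ^ 6 - 45 * B ^ 4 * C ^ 5 + 70 * B ^ 4 * C ^ 4 - 75 * B ^ 4 * C ^ 3
      + 15 * B ^ 4 * C ^ 2 + 5 * B * C ^ 6 + 6 * B * C ^ 5) * h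

theorem map_lam₁ {S : Type*} [CommRing S] (φ : R →+* S) (A B C : R) :
    φ (lam₁ A B C) = lam₁ (φ A) (φ B) (φ C) := by
  simp only [lam₁, lam₁₂, lam₁₁, lam₁₀, map_add, map_sub, map_neg, map_mul, map_pow,
    map_ofNat]

theorem map_lam₂ {S : Type*} [CommRing S] (φ : R →+* S) (A B C : R) :
    φ (lam₂ A B C) = lam₂ (φ A) (φ B) (φ C) := by
  simp only [lam₂, lam₂₂, lam₂₁, lam₂₀, map_add, map_sub, map_neg, map_mul, map_pow,
    map_ofNat]

theorem map_lam₃ {S : Type*} [CommRing S] (φ : R →+* S) (A B C : R) :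
    φ (lam₃ A B C) = lam₃ (φ A) (φ B) (φ C) := by
  simp only [lam₃, lam₃₂, lam₃₁, lam₃₀, map_add, map_sub, map_neg, map_mul, map_pow, map_one,
    map_ofNat]

end Identities

/-! ### Common zeros of the conjugate conics -/

section BasePoints

variable {L : Type*} [Field L]

/-- Elimination of `c` from the three conics; the combination yields the cubic times `a * c`, hence
the nonvanishing hypotheses. -/
theorem cubic_eq_zero_of_conic {A B C a b c : L} (h : surf A B C = 0)
    (ha : a ≠ 0) (hc : c ≠ 0)
    (h₁ : conic A B C a b c = 0) (h₂ : conic A B C b c a = 0) (h₃ : conic A B C c a b = 0) :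
    (B * C - A) * a ^ 3 - (A ^ 3 + B ^ 3) * a ^ 2 * b
      - (1 + C) * (A ^ 2 - A * B + B ^ 2) * a * b ^ 2 - (B * C - A) * b ^ 3 = 0 := by
  refine (mul_eq_zero.mp ?_).resolve_left (mul_ne_zero ha hc)
  unfold conic at h₁ h₂ h₃
  unfold surf at h
  linear_combination (A * a * b ^ 2 - B ^ 2 * b ^ 2 * c - B * C * a * b ^ 2 - B * a * b ^ 2
      - A * a ^ 2 * c - B * b * c ^ 2 - C * a * b * c + a * b * c - B ^ 2 * a ^ 2 * b) * h₁
    + (B * a * b * c - A ^ 2 * a * b ^ 2 + A * B * a * b ^ 2 + B * a ^ 3 + C * a ^ 2 * b) * h₂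
    + (-A * B * a * b * c + B ^ 2 * a * b * c + B * C * b ^ 2 * c + A * B * b ^ 3 - a * b ^ 2) * h₃
    + (-a ^ 3 * b * c + a * b ^ 2 * c ^ 2) * h

theorem cubic_eq_zero_of_conic' {A B C a b c : L} (h : surf A B C = 0)
    (h₁ : conic A B C a b c = 0) (h₂ : conic A B C b c a = 0) (h₃ : conic A B C c a b = 0) :
    (1 + A * B ^ 2) * a ^ 3 - (B ^ 2 - A ^ 2 - B ^ 2 * C - A * B * C) * a ^ 2 * b
      + (-2 * B + A + B * C + A * C - A * B ^ 3 + A ^ 2 * B ^ 2 - A ^ 3 * B) * a * b ^ 2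
      - (1 + A * B ^ 2) * b ^ 3 = 0 := by
  unfold conic at h₁ h₂ h₃
  unfold surf at h
  linear_combination (-B ^ 2 * b - B * c + a) * h₁ - b * h₂
    + (A * b + B ^ 2 * a + B * C * b) * h₃ - B * a * b ^ 2 * h

theorem lam_cubic_eq_zero_of_conic {A B C a b c : L} (h : surf A B C = 0)
    (ha : a ≠ 0) (hc : c ≠ 0)
    (h₁ : conic A B C a b c = 0) (h₂ : conic A B C b c a = 0) (h₃ : conic A B C c a b = 0) :
    lam₁ A B C * a ^ 3 + lam₂ A B C * a ^ 2 * b + lam₃ A B C * a * b ^ 2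
      + lam₄ A B C * b ^ 3 = 0 := by
  rw [lam₄, lam₁_eq, lam₂_eq h, lam₃_eq h]
  linear_combination mulG A B C * cubic_eq_zero_of_conic h ha hc h₁ h₂ h₃
    + mulH B C * cubic_eq_zero_of_conic' h h₁ h₂ h₃

theorem lam_sum_eq_zero {A B C : L} (hB : B = A * C) (hC : C ^ 2 - C + 1 = 0) :
    lam₁ A B C + lam₂ A B C + lam₃ A B C + lam₄ A B C = 0 := by
  have h : surf A B C = 0 := by
    unfold surf
    rw [hB]
    linear_combination (A ^ 3 + 1) * hC
  rw [lam₄, lam₁_eq, lam₂_eq h, lam₃_eq h]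
  subst hB
  generalize mulG A (A * C) C = g, mulH (A * C) C = k
  linear_combination (g * (-A ^ 3 * (C + 1) - A ^ 2 * (1 + C)) + k * (-A ^ 4 * C + A ^ 2 * C + A ^ 2 + A)) * hC

end BasePoints

/-! ### Trace-form duality -/

section LinearAlgebra

variable {K L : Type*} [Field K] [Field L] [Algebra K L]

/-- A non-scalar element is orthogonal, for the trace form of a cubic extension, to the range of an
endomorphism of rank at most one. -/
theorem exists_orthogonal_range [Algebra.IsSeparable K L] (hL : Module.finrank K L = 3)
    (T : L →ₗ[K] L) {a₁ a₂ : L} (h₁ : T a₁ = 0) (h₂ : T a₂ = 0)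
    (hli : LinearIndependent K ![a₁, a₂]) :
    ∃ d : L, d ∉ Set.range (algebraMap K L) ∧ ∀ a, Algebra.trace K L (d * T a) = 0 := by
  have hfin : FiniteDimensional K L := Module.finite_of_finrank_eq_succ hL
  have hker : 2 ≤ Module.finrank K T.ker := by
    have hli' : LinearIndependent K ![(⟨a₁, h₁⟩ : T.ker), ⟨a₂, h₂⟩] := by
      apply LinearIndependent.of_comp T.ker.subtype
      convert hli using 1
      ext i
      fin_cases i <;> rfl
    simpa using hli'.fintype_card_le_finrank
  -- Rank at most 1 leaves an orthogonal complement of dimension at least 2, too large to fit in the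
  -- line of scalars.
  have hrn := T.finrank_range_add_finrank_ker
  have horth := LinearMap.BilinForm.finrank_orthogonal (traceForm_nondegenerate K L) T.range
  by_contra! hcon
  have hle : (Algebra.traceForm K L).orthogonal T.range ≤ Submodule.span K {1} := by
    intro d hd
    by_contra hd1
    have hd2 : d ∉ Set.range (algebraMap K L) := by
      rintro ⟨k, rfl⟩
      exact hd1 (Submodule.mem_span_singleton.mpr ⟨k, by rw [Algebra.algebraMap_eq_smul_one]⟩)
    obtain ⟨a, ha⟩ := hcon d hd2
    apply ha
    have : Algebra.traceForm K L (T a) d = 0 := hd (T a) ⟨a, rfl⟩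
    rwa [Algebra.traceForm_apply, mul_comm] at this
  have h1 := Submodule.finrank_mono hle
  have h2 := finrank_span_singleton (K := K) (one_ne_zero (α := L))
  omega

/-- If an endomorphism of `L` pairs, under the trace form, to zero with a nonzero element, then it
has a nontrivial kernel. -/
theorem exists_ne_zero_of_trace_mul_eq_zero [FiniteDimensional K L] [Algebra.IsSeparable K L]
    (G : L →ₗ[K] L) {w : L} (hw : w ≠ 0) (h : ∀ a, Algebra.trace K L (w * G a) = 0) :
    ∃ a, a ≠ 0 ∧ G a = 0 := by
  by_contra! hcon
  have hinj : Function.Injective G := (injective_iff_map_eq_zero G).mpr fun a ha => by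
    by_contra h0
    exact hcon a h0 ha
  have hsurj : Function.Surjective G := LinearMap.injective_iff_surjective.mp hinj
  refine hw ((traceForm_nondegenerate K L).1 w fun z => ?_)
  obtain ⟨a, rfl⟩ := hsurj z
  exact h a

end LinearAlgebra

/-! ### The syzygy as a linear map, and its adjoint -/

section CubicExtension

variable {K L : Type*} [Field K] [Field L] [Algebra K L]

/-- The syzygy form: linear in `w`, where it is to be evaluated at a value of the quadratic map, and
linear in the point `a`. -/
def syz (σ : L →ₐ[K] L) (A B C w : L) : L → L := fun a =>
  syzV A B C a (σ a) (σ (σ a)) * w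
    + (syzU A B C (σ a) (σ (σ a)) a - syzV A B C (σ a) (σ (σ a)) a) * σ w
    - syzU A B C (σ (σ a)) a (σ a) * σ (σ w)

/-- `syz` as a linear map in the point. -/
def syzLin (σ : L →ₐ[K] L) (A B C w : L) : L →ₗ[K] L where
  toFun := syz σ A B C w
  map_add' x y := by
    simp only [syz, syzU, syzV, map_add]
    ring
  map_smul' k x := by
    simp only [syz, syzU, syzV, Algebra.smul_def, RingHom.id_apply, map_mul, AlgHom.commutes]
    ring

/-- For `e = σ d - d`, the linear map `a ↦ Tr (d * syz σ A B C w a)` is `a ↦ Tr (w * syzAdj σ A B C e a)`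
when `A`, `B`, `C` are scalars; see `trace_mul_syz`. -/
def syzAdj (σ : L →ₐ[K] L) (A B C e : L) : L →ₗ[K] L where
  toFun a := σ (σ e) * syzV A B C a (σ a) (σ (σ a)) + σ e * syzU A B C a (σ a) (σ (σ a))
  map_add' x y := by
    simp only [syzU, syzV, map_add]
    ring
  map_smul' k x := by
    simp only [syzU, syzV, Algebra.smul_def, RingHom.id_apply, map_mul, AlgHom.commutes]
    ring

variable {σ : L →ₐ[K] L}

theorem trace_map (hσ : ∀ x, σ (σ (σ x)) = x)
    (htr : ∀ x, algebraMap K L (Algebra.trace K L x) = x + σ x + σ (σ x)) (x : L) :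
    Algebra.trace K L (σ x) = Algebra.trace K L x := by
  apply (algebraMap K L).injective
  rw [htr, htr, hσ]
  ring

/-- Conjugating each term under the trace until `w` stands bare leaves only differences of
conjugates of `d`. Scalar `d` thus carry no information. -/
theorem trace_mul_syz (hσ : ∀ x, σ (σ (σ x)) = x)
    (htr : ∀ x, algebraMap K L (Algebra.trace K L x) = x + σ x + σ (σ x))
    {A B C : K} (d w a : L) :
    Algebra.trace K L
        (d * syz σ (algebraMap K L A) (algebraMap K L B) (algebraMap K L C) w a) =
      Algebra.trace K L (w * syzAdj σ (algebraMap K L A) (algebraMap K L B) (algebraMap K L C)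
        (σ d - d) a) := by
  apply (algebraMap K L).injective
  rw [htr, htr]
  simp only [syz, syzAdj, LinearMap.coe_mk, AddHom.coe_mk, syzU, syzV, map_add, map_sub, map_mul,
    map_pow, map_one, hσ, AlgHom.commutes]
  ring

/-- Put `e = σ d - d`. Since `e + σ e + σ (σ e) = 0`, the two further conjugates of `ha` form a
homogeneous 2×2 system in `e ≠ 0` and `σ e`, so its determinant, `(B - A * C)` times the conic,
vanishes. -/
theorem conic_eq_zero_of_syzAdj_eq_zero (hσ : ∀ x, σ (σ (σ x)) = x) {A B C : K}
    (h : surf A B C = 0) (hBC : B ≠ A * C) {d a : L} (hd : σ d ≠ d)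
    (ha : syzAdj σ (algebraMap K L A) (algebraMap K L B) (algebraMap K L C) (σ d - d) a = 0) :
    conic (algebraMap K L A) (algebraMap K L B) (algebraMap K L C) a (σ a) (σ (σ a)) = 0 := by
  have h' : surf (algebraMap K L A) (algebraMap K L B) (algebraMap K L C) = 0 := by
    have := congrArg (algebraMap K L) h
    simpa [surf] using this
  have hκ : algebraMap K L B - algebraMap K L A * algebraMap K L C ≠ 0 := by
    rw [← map_mul, sub_ne_zero]
    exact fun h0 => hBC ((algebraMap K L).injective h0)
  have hmin := syzygy_minor h' a (σ a) (σ (σ a))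
  have ha1 := congrArg σ ha
  have ha2 := congrArg (σ ∘ σ) ha
  simp only [Function.comp_apply, syzAdj, LinearMap.coe_mk, AddHom.coe_mk, syzU, syzV, map_add,
    map_sub, map_mul, map_pow, map_one, map_zero, hσ, AlgHom.commutes] at ha1 ha2
  refine (mul_eq_zero.mp ?_).resolve_left (mul_ne_zero (sub_ne_zero.mpr hd) hκ)
  rw [mul_assoc, ← hmin]
  unfold syzU syzV
  set α := algebraMap K L A
  set β := algebraMap K L B
  set γ := algebraMap K L C
  set x := a
  set y := σ a
  set z := σ (σ a)
  linear_combination (α ^ 2 * z + (α - β) * x - γ * y) * ha1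
    + (α * β * y + α * z + (1 - γ) * x) * ha2

end CubicExtension

/-! ### Injectivity of `f` -/

section Permutation

variable {K L : Type*} [Field K] [Field L] [Algebra K L]

theorem surf_map {A B C : K} (h : surf A B C = 0) :
    surf (algebraMap K L A) (algebraMap K L B) (algebraMap K L C) = 0 := by
  simpa [surf] using congrArg (algebraMap K L) h

theorem syz_conic {σ : L →ₐ[K] L} (hσ : ∀ x, σ (σ (σ x)) = x) {A B C : K}
    (h : surf A B C = 0) (a : L) :
    syz σ (algebraMap K L A) (algebraMap K L B) (algebraMap K L C)
      (conic (algebraMap K L A) (algebraMap K L B) (algebraMap K L C) a (σ a) (σ (σ a))) a = 0 := by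
  have := syzygy (surf_map (L := L) h) a (σ a) (σ (σ a))
  rw [← this]
  simp only [syz, conic, map_add, map_mul, map_pow, hσ, AlgHom.commutes]

theorem syz_mul_left {σ : L →ₐ[K] L} {k : L} (hk : σ k = k) (A B C w a : L) :
    syz σ A B C (k * w) a = k * syz σ A B C w a := by
  simp only [syz, map_mul, hk]
  ring

theorem exists_smul_eq_of_syz_eq_zero [Algebra.IsSeparable K L] (hL : Module.finrank K L = 3)
    {σ : L →ₐ[K] L} (hσ : ∀ x, σ (σ (σ x)) = x)
    (htr : ∀ x, algebraMap K L (Algebra.trace K L x) = x + σ x + σ (σ x))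
    (hfix : ∀ x, σ x = x → x ∈ Set.range (algebraMap K L)) {A B C : K}
    (h : surf A B C = 0) (hBC : B ≠ A * C)
    (hne : ∀ a : L, a ≠ 0 →
      conic (algebraMap K L A) (algebraMap K L B) (algebraMap K L C) a (σ a) (σ (σ a)) ≠ 0)
    {w a₁ a₂ : L} (hw : w ≠ 0) (ha₁ : a₁ ≠ 0)
    (h₁ : syz σ (algebraMap K L A) (algebraMap K L B) (algebraMap K L C) w a₁ = 0)
    (h₂ : syz σ (algebraMap K L A) (algebraMap K L B) (algebraMap K L C) w a₂ = 0) :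
    ∃ k : K, k • a₁ = a₂ := by
  have hfin : FiniteDimensional K L := Module.finite_of_finrank_eq_succ hL
  by_contra! hcon
  obtain ⟨d, hd, hdtr⟩ := exists_orthogonal_range hL
    (syzLin σ (algebraMap K L A) (algebraMap K L B) (algebraMap K L C) w) h₁ h₂
    ((LinearIndependent.pair_iff' ha₁).mpr hcon)
  obtain ⟨a, ha, ha0⟩ := exists_ne_zero_of_trace_mul_eq_zero
    (syzAdj σ (algebraMap K L A) (algebraMap K L B) (algebraMap K L C) (σ d - d)) hw
    fun a => by rw [← trace_mul_syz hσ htr]; exact hdtr a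
  exact hne a ha (conic_eq_zero_of_syzAdj_eq_zero hσ h hBC (fun h0 => hd (hfix d h0)) ha0)

theorem aeval_f_mul {σ : L →ₐ[K] L} {q : ℕ} (hq : 1 ≤ q) (hσq : ∀ x, σ x = x ^ q) (A B C : K)
    (x : L) :
    aeval x (f q A B C) * (x * σ x * σ (σ x)) =
      conic (algebraMap K L A) (algebraMap K L B) (algebraMap K L C)
        (σ x * σ (σ x)) (σ (σ x) * x) (x * σ x) := by
  have e₁ : q ^ 2 + q = q ^ 2 + q - 1 + 1 := by omega
  have e₂ : q ^ 2 + 1 = q ^ 2 - q + 1 + q := by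
    have : q ≤ q ^ 2 := by nlinarith
    omega
  have p₁ : x ^ (q ^ 2 + q - 1) * x = σ x * σ (σ x) := by
    rw [hσq, hσq, ← pow_succ, ← e₁, ← pow_mul, ← pow_add]
    ring_nf
  have p₂ : x ^ (q ^ 2 - q + 1) * σ x = σ (σ x) * x := by
    rw [hσq, hσq, ← pow_add, ← e₂, ← pow_mul, ← pow_succ]
    ring_nf
  simp only [f, map_add, map_mul, aeval_X_pow, aeval_C, aeval_X, conic, ← hσq]
  linear_combination (σ x * σ (σ x)) * p₁ + (algebraMap K L A * x * σ (σ x)) * p₂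

theorem aeval_f_smul {σ : L →ₐ[K] L} {q : ℕ} (hq : 1 ≤ q) (hσq : ∀ x, σ x = x ^ q)
    (A B C k : K) (x : L) :
    aeval (k • x) (f q A B C) = k • aeval x (f q A B C) := by
  rcases eq_or_ne k 0 with rfl | hk
  -- The truncated exponent must be positive for its monomial to vanish at 0.
  · have : q ^ 2 + q - 1 ≠ 0 := by nlinarith [Nat.sub_add_cancel (show 1 ≤ q ^ 2 + q by nlinarith)]
    simp [f, this, show q ≠ 0 by omega]
  rcases eq_or_ne x 0 with rfl | hx
  · have : q ^ 2 + q - 1 ≠ 0 := by nlinarith [Nat.sub_add_cancel (show 1 ≤ q ^ 2 + q by nlinarith)]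
    simp [f, this, show q ≠ 0 by omega]
  have hinj := (injective_iff_map_eq_zero σ).mp σ.toRingHom.injective
  have hσ0 : ∀ y, y ≠ 0 → σ y ≠ 0 := fun y hy h0 => hy (hinj y h0)
  have hx1 := hσ0 x hx
  have hx2 := hσ0 _ hx1
  have hk' : algebraMap K L k ≠ 0 := by simpa using hk
  have h1 := aeval_f_mul hq hσq A B C x
  have h2 := aeval_f_mul hq hσq A B C (k • x)
  simp only [Algebra.smul_def, map_mul, AlgHom.commutes] at h2 ⊢
  have hN : algebraMap K L k ^ 3 * (x * σ x * σ (σ x)) ≠ 0 :=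
    mul_ne_zero (pow_ne_zero 3 hk') (mul_ne_zero (mul_ne_zero hx hx1) hx2)
  apply mul_right_cancel₀ hN
  unfold conic at h1 h2
  linear_combination h2 - algebraMap K L k ^ 4 * h1

theorem conic_ne_zero {σ : L →ₐ[K] L} {q : ℕ} (hσ : ∀ x, σ (σ (σ x)) = x)
    (hσq : ∀ x, σ x = x ^ q) {A B C : K} (h : surf A B C = 0)
    (hm : ∀ u ∈ mu L (q ^ 2 + q + 1), aeval u (m A B C) ≠ 0) (a : L) (ha : a ≠ 0) :
    conic (algebraMap K L A) (algebraMap K L B) (algebraMap K L C) a (σ a) (σ (σ a)) ≠ 0 := by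
  intro h₁
  have h₂ := congrArg σ h₁
  have h₃ := congrArg (σ ∘ σ) h₁
  simp only [Function.comp_apply, conic, map_add, map_mul, map_pow, map_zero, hσ,
    AlgHom.commutes] at h₂ h₃
  have hinj := (injective_iff_map_eq_zero σ).mp σ.toRingHom.injective
  have hb : σ a ≠ 0 := fun h0 => ha (hinj _ h0)
  have hc : σ (σ a) ≠ 0 := fun h0 => hb (hinj _ h0)
  have key := lam_cubic_eq_zero_of_conic (surf_map (L := L) h) ha hc h₁ h₂ h₃
  -- The exponent `q ^ 2 + q + 1` computes the norm, and `a / σ a` has norm 1.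
  refine hm (a / σ a) ?_ ?_
  · have e : ∀ u : L, u ^ (q ^ 2 + q + 1) = σ (σ u) * σ u * u := fun u => by
      rw [hσq, hσq]
      ring
    rw [mu, Set.mem_ofPred_eq, e, map_div₀, map_div₀, hσ]
    field_simp
  · simp only [m, map_add, map_mul, aeval_C, aeval_X, map_pow]
    rw [lam₄] at key
    rw [lam₄, map_neg, map_lam₁, map_lam₂, map_lam₃]
    field_simp
    linear_combination key

/-- If `B = A * C`, the surface equation factors as `(A ^ 3 + 1) * (C ^ 2 - C + 1) = 0`, and the
second factor makes the coefficients of `m` sum to zero. -/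
theorem ne_mul_of_forall_mu {q : ℕ} {A B C : K} (hA : A ^ 3 + 1 ≠ 0) (h : surf A B C = 0)
    (hm : ∀ u ∈ mu L (q ^ 2 + q + 1), aeval u (m A B C) ≠ 0) : B ≠ A * C := by
  intro hB
  have hC : C ^ 2 - C + 1 = 0 := by
    refine (mul_eq_zero.mp ?_).resolve_left hA
    rw [← h, surf, hB]
    ring
  refine hm 1 (by simp [mu]) ?_
  have := congrArg (algebraMap K L) (lam_sum_eq_zero hB hC)
  simpa [m] using this

theorem aeval_f_injective [Algebra.IsSeparable K L] (hL : Module.finrank K L = 3)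
    {σ : L →ₐ[K] L} {q : ℕ} (hq : 1 ≤ q) (hσq : ∀ x, σ x = x ^ q) (hσ : ∀ x, σ (σ (σ x)) = x)
    (htr : ∀ x, algebraMap K L (Algebra.trace K L x) = x + σ x + σ (σ x))
    (hfix : ∀ x, σ x = x → x ∈ Set.range (algebraMap K L)) {A B C : K}
    (hA : A ^ 3 + 1 ≠ 0) (h : surf A B C = 0)
    (hm : ∀ u ∈ mu L (q ^ 2 + q + 1), aeval u (m A B C) ≠ 0) :
    Function.Injective fun c : L => aeval c (f q A B C) := by
  have hinj := (injective_iff_map_eq_zero σ).mp σ.toRingHom.injective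
  have hσ0 : ∀ y, y ≠ 0 → σ y ≠ 0 := fun y hy h0 => hy (hinj y h0)
  have hne := conic_ne_zero hσ hσq h hm
  have hconj : ∀ x, conic (algebraMap K L A) (algebraMap K L B) (algebraMap K L C)
      (σ x * σ (σ x)) (σ (σ x) * x) (x * σ x) =
      conic (algebraMap K L A) (algebraMap K L B) (algebraMap K L C)
      (σ x * σ (σ x)) (σ (σ x * σ (σ x))) (σ (σ (σ x * σ (σ x)))) := fun x => by
    simp only [map_mul, hσ]
  have hf0 : ∀ x : L, aeval x (f q A B C) = 0 → x = 0 := fun x hx => by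
    by_contra hx0
    refine hne (σ x * σ (σ x)) (mul_ne_zero (hσ0 _ hx0) (hσ0 _ (hσ0 _ hx0))) ?_
    rw [← hconj, ← aeval_f_mul hq hσq, hx, zero_mul]
  have hz : aeval (0 : L) (f q A B C) = 0 := by
    simpa using aeval_f_smul (L := L) hq hσq A B C 0 0
  have hsyz : ∀ x : L, x ≠ 0 →
      syz σ (algebraMap K L A) (algebraMap K L B) (algebraMap K L C) (aeval x (f q A B C))
        (σ x * σ (σ x)) = 0 := fun x hx => by
    refine (mul_eq_zero.mp ?_).resolve_left
      (mul_ne_zero (mul_ne_zero hx (hσ0 _ hx)) (hσ0 _ (hσ0 _ hx)))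
    rw [← syz_mul_left (by simp only [map_mul, hσ]; ring), mul_comm, aeval_f_mul hq hσq, hconj]
    exact syz_conic hσ h _
  intro x y hxy
  simp only at hxy
  rcases eq_or_ne x 0 with rfl | hx
  · exact (hf0 y (by rw [← hxy, hz])).symm
  rcases eq_or_ne y 0 with rfl | hy
  · exact hf0 x (by rw [hxy, hz])
  have hw : aeval x (f q A B C) ≠ 0 := fun h0 => hx (hf0 x h0)
  obtain ⟨k, hk⟩ := exists_smul_eq_of_syz_eq_zero hL hσ htr hfix h
    (ne_mul_of_forall_mu hA h hm) hne hw (mul_ne_zero (hσ0 _ hx) (hσ0 _ (hσ0 _ hx)))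
    (hsyz x hx) (by rw [hxy]; exact hsyz y hy)
  -- Proportionality of `N x / x` and `N y / y` over `K` makes `y / x` Frobenius-invariant.
  obtain ⟨l, hl⟩ := hfix (y / x) (by
    have hk1 := congrArg σ hk
    rw [Algebra.smul_def] at hk
    simp only [Algebra.smul_def, map_mul, hσ, AlgHom.commutes] at hk1
    have hk0 : algebraMap K L k ≠ 0 := by
      intro h0
      rw [h0, zero_mul] at hk
      exact mul_ne_zero (hσ0 _ hy) (hσ0 _ (hσ0 _ hy)) hk.symm
    have hx1 := hσ0 _ hx
    have hx2 := hσ0 _ hx1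
    rw [map_div₀, div_eq_div_iff hx1 hx]
    apply mul_left_cancel₀ (mul_ne_zero (mul_ne_zero hk0 hx2) (hσ0 _ (hσ0 _ hy)))
    linear_combination (σ y * σ (σ y)) * hk1 - (σ (σ y) * y) * hk)
  have hyx : y = l • x := by
    rw [Algebra.smul_def, hl, div_mul_cancel₀ _ hx]
  rw [hyx, aeval_f_smul hq hσq, Algebra.smul_def] at hxy
  have hl1 : algebraMap K L l = 1 := mul_right_cancel₀ hw (by rw [one_mul]; exact hxy.symm)
  rw [hyx, Algebra.smul_def, hl1, one_mul]

end Permutation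

end PermQuad

theorem theorem3p9 {K L : Type*} [Field K] [Finite K] [Field L] [Algebra K L]
    (hL : Module.finrank K L = 3) (q : ℕ) (hq : Nat.card K = q) (A B C : K)
    (hA₁ : A ≠ -1) (hA₂ : A ≠ 0) (hA₃ : A ≠ 1)
    (hA₄ : A ^ 2 - A + 1 ≠ 0)
    (hABC : A * B ^ 2 + C ^ 2 ≠ 0)
    (hAB : A ^ 3 - 2 * A ^ 2 * B + A * B ^ 2 + 1 ≠ 0)
    (h : A ^ 3 - A ^ 2 * B + A * B ^ 2 + C ^ 2 - C + 1 = 0)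
    (hr₁ : PermQuad.r₁ A B ≠ 0) (hr₂ : PermQuad.r₂ A B ≠ 0)
    (hm : ∀ u ∈ PermQuad.mu L (q ^ 2 + q + 1), aeval u (PermQuad.m A B C) ≠ 0) :
    PermQuad.IsPermutationPolynomialOver L (PermQuad.f q A B C) := by
  have hfin : FiniteDimensional K L := Module.finite_of_finrank_eq_succ hL
  have hLfin : Finite L := Module.finite_of_finite K
  have := Fintype.ofFinite K
  have hcard : Fintype.card K = q := by rw [← hq, Nat.card_eq_fintype_card]
  have hq1 : 1 ≤ q := hcard ▸ Fintype.card_pos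
  have hσq : ∀ x, FiniteField.frobeniusAlgHom K L x = x ^ q := fun x => by
    rw [FiniteField.coe_frobeniusAlgHom, hcard]
  have htr : ∀ x, algebraMap K L (Algebra.trace K L x) = x + FiniteField.frobeniusAlgHom K L x +
      FiniteField.frobeniusAlgHom K L (FiniteField.frobeniusAlgHom K L x) := fun x => by
    rw [FiniteField.algebraMap_trace_eq_sum_pow, hL, hq, hσq, hσq]
    simp [Finset.sum_range_succ, ← pow_mul, sq]
  have hσ : ∀ x, FiniteField.frobeniusAlgHom K L (FiniteField.frobeniusAlgHom K L
      (FiniteField.frobeniusAlgHom K L x)) = x := fun x => by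
    have h3 := pow_orderOf_eq_one (FiniteField.frobeniusAlgHom K L)
    rw [FiniteField.orderOf_frobeniusAlgHom, hL] at h3
    exact DFunLike.congr_fun h3 x
  have hfix : ∀ x, FiniteField.frobeniusAlgHom K L x = x → x ∈ Set.range (algebraMap K L) := by
    intro x hx
    rw [IsGalois.mem_range_algebraMap_iff_fixed]
    intro g
    -- Frobenius generates the Galois group, so its fixed points are scalars.
    obtain ⟨n, rfl⟩ := (FiniteField.bijective_frobeniusAlgEquivOfAlgebraic_pow K L).2 g
    have hx' : FiniteField.frobeniusAlgEquivOfAlgebraic K L x = x := hx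
    rw [AlgEquiv.coe_pow]
    exact Function.iterate_fixed hx' _
  refine Finite.injective_iff_bijective.mp
    (PermQuad.aeval_f_injective hL hq1 hσq hσ htr hfix ?_ h hm)
  rw [show A ^ 3 + 1 = (A + 1) * (A ^ 2 - A + 1) by ring]
  exact mul_ne_zero (fun h0 => hA₁ (eq_neg_of_add_eq_zero_left h0)) hA₄
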